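/- Equip $\mathbb R^n$ with the norm $|x|=\max_i|x_i|$. Let $\Delta(\mathbb R^n)$ be the collection of all dyadic cubes $\prod_{i=1}^n[m_i2^k,(m_i+1)2^k]$ with $k\in\mathbb Z$, $m\in\mathbb Z^n$, and for $R\in\Delta(\mathbb R^n)$ let $\Delta(R)=\{Q\in\Delta(\mathbb R^n):Q\subset R\}$. For an axis-parallel cube $Q$ let $\mathrm{side}(Q)$ be its sidelength and let $3Q$ be the cube with the same center and three times the sidelength. For a map $f:\mathbb R^n\to\mathcal M$ into a metric space put $$\mathrm{md}(Q)=\mathrm{md}_f(Q):=\frac1{\mathrm{side}(Q)}\,\inf_{\|\cdot\|}\ \sup_{x,y\in Q}\Big|\,\mathrm{dist}(f(x),f(y))-\|x-y\|\,\Big|,$$ where the infimum is taken over all seminorms $\|\cdot\|$ on $\mathbb R^n$. **Theorem.** For every $n$ and every $\delta>0$ there is a finite constant $C_{\delta,n}$, depending only on $\delta$ and $n$, such that for every metric space $\mathcal M$, every $L\ge 0$, every map $f:\mathbb R^n\to\mathcal M$ with $\mathrm{dist}(f(x),f(y))\le L|x-y|$ for all $x,y\in\mathbb R^n$, and every $R\in\Delta(\mathbb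 R^n)$, $$\sum\{\mathrm{vol}(Q): Q\in\Delta(R),\ \mathrm{md}(3Q)>\delta L\}\le C_{\delta,n}\,\mathrm{vol}(R).$$ -/

import Mathlib

open MeasureTheory
open scoped NNReal ENNReal

noncomputable section

/-- A closed axis-parallel cube in `ℝⁿ`, given by its center and its (positive) sidelength. Here
`ℝⁿ` is `Fin n → ℝ`, whose norm and distance are the `ℓ_∞` ones. -/
structure Cube (n : ℕ) where
  center : Fin n → ℝ
  side : ℝ
  side_pos : 0 < side

namespace Cube

/-- The set of points of the cube: the product of the intervals
`[center i - side / 2, center i + side / 2]`. -/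
def toSet {n : ℕ} (Q : Cube n) : Set (Fin n → ℝ) :=
  Set.Icc (fun i => Q.center i - Q.side / 2) (fun i => Q.center i + Q.side / 2)

/-- The cube `3Q` with the same center as `Q` and three times its sidelength. -/
def triple {n : ℕ} (Q : Cube n) : Cube n where
  center := Q.center
  side := 3 * Q.side
  side_pos := mul_pos three_pos Q.side_pos

/-- The dyadic cube `∏ i, [m i * 2 ^ k, (m i + 1) * 2 ^ k]` of sidelength `2 ^ k`, for `k ∈ ℤ` and
`m ∈ ℤⁿ`. -/
def dyadic {n : ℕ} (k : ℤ) (m : Fin n → ℤ) : Cube n where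
  center := fun i => ((m i : ℝ) + 1 / 2) * (2 : ℝ) ^ k
  side := (2 : ℝ) ^ k
  side_pos := zpow_pos two_pos k

end Cube

/-- The collection `Δ(ℝⁿ)` of all dyadic cubes in `ℝⁿ`. -/
def dyadicCubes (n : ℕ) : Set (Cube n) :=
  {Q | ∃ (k : ℤ) (m : Fin n → ℤ), Q = Cube.dyadic k m}

/-- The collection `Δ(R)` of the dyadic cubes contained in `R`. -/
def dyadicSubcubes {n : ℕ} (R : Cube n) : Set (Cube n) :=
  {Q | Q ∈ dyadicCubes n ∧ Q.toSet ⊆ R.toSet}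

/-- `md(Q) = side(Q)⁻¹ inf_p sup_{x, y ∈ Q} |dist (f x) (f y) - p (x - y)|`, the infimum over all
seminorms `p` on `ℝⁿ`. It takes values in `[0, ∞]`, where all suprema and infima are genuine. -/
def md {n : ℕ} {M : Type*} [MetricSpace M] (f : (Fin n → ℝ) → M) (Q : Cube n) : ℝ≥0∞ :=
  (⨅ p : Seminorm ℝ (Fin n → ℝ), ⨆ x ∈ Q.toSet, ⨆ y ∈ Q.toSet,
    ENNReal.ofReal |dist (f x) (f y) - p (x - y)|) / ENNReal.ofReal Q.side

end

/-!
Divide the pullback metric by `L`, so that it becomes a pseudodistance `ρ ≤ ‖x - y‖` on `ℝⁿ`. For a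
step `w` compare the squared speed of `ρ` on the two short steps `x → x + w → x + 2w` with that on
the long step `x → x + 2w`. By the triangle inequality and convexity of the square the speed can
only drop; call the drop the *defect* (`midDefect`). It measures at the same time the failure of
`ρ` to be additive along lines and the failure of its speed to be constant.

*Rigidity.* If all defects vanish, then `ρ (x, x + 2w) = 2 ρ (x, x + w)` for all `x` and `w`.
Iterating, and comparing two base points after blowing up by `2 ^ m`, shows that `ρ` is translation
invariant, hence a seminorm (`exists_seminorm_of_midDefect_eq_zero`). The set of all pseudodistances
bounded by the norm is compact in the product topology, so there are finitely many pairs `(x, w)`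
and an `ε > 0` such that each `ρ` has a defect larger than `ε` at one of the pairs, or is `δ`-close
to a seminorm on a given compact set (`exists_finset_midDefect_or_seminorm`). Applied to the
rescaled copies of `ρ` on the cubes `3Q`, this says that each cube of the sum has a defect larger
than `ε` at one of finitely many relative positions and steps.

*Packing.* Fix one such pair `(x, w)`. The scale-`2h` speed occurs with opposite signs in the
defects at scales `h` and `2h`, so the integrals of the defects over all dyadic scales telescope,
and their sum is bounded by the volume of a dilate of `R` (`tsum_lintegral_scaledDefect_le`).
Defects are Lipschitz in the base point, so a cube with a large defect contributes a fixed
proportion of its volume to the integral at its scale (`tsum_pow_le_lintegral_scaledDefect`).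
-/

/-! ### Pseudodistances with small defects are close to seminorms -/

section ShortPseudoDist

variable {E : Type*} [NormedAddCommGroup E]

/-- `ρ` is a pseudodistance on `E` bounded by the distance of the norm. -/
structure IsShortPseudoDist (ρ : E → E → ℝ) : Prop where
  self : ∀ x, ρ x x = 0
  symm : ∀ x y, ρ x y = ρ y x
  triangle : ∀ x y z, ρ x z ≤ ρ x y + ρ y z
  le_norm : ∀ x y, ρ x y ≤ ‖x - y‖

/-- The amount by which the squared speed of `ρ` drops when the two steps `x → x + w → x + 2w`
are replaced by the single step `x → x + 2w`. -/
noncomputable def midDefect (ρ : E → E → ℝ) (x w : E) : ℝ :=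
  (ρ x (x + w) ^ 2 + ρ (x + w) (x + w + w) ^ 2) / 2 - (ρ x (x + w + w) / 2) ^ 2

namespace IsShortPseudoDist

variable {ρ : E → E → ℝ}

theorem nonneg (h : IsShortPseudoDist ρ) (x y : E) : 0 ≤ ρ x y := by
  have h1 := h.triangle x y x
  rw [h.self, h.symm y x] at h1
  linarith

theorem abs_sub_le (h : IsShortPseudoDist ρ) (x y x' y' : E) :
    |ρ x y - ρ x' y'| ≤ ‖x - x'‖ + ‖y - y'‖ := by
  have h1 := h.triangle x x' y
  have h2 := h.triangle x' y' y
  have h3 := h.triangle x' x y'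
  have h4 := h.triangle x y y'
  have h5 := h.le_norm x x'
  have h6 := h.le_norm y y'
  rw [h.symm x' x] at h3
  rw [h.symm y' y] at h2
  rw [abs_le]
  constructor <;> linarith

theorem continuous (h : IsShortPseudoDist ρ) : Continuous fun q : E × E => ρ q.1 q.2 := by
  rw [Metric.continuous_iff]
  intro b ε hε
  refine ⟨ε / 2, half_pos hε, fun a ha => ?_⟩
  rw [Prod.dist_eq, max_lt_iff, dist_eq_norm, dist_eq_norm] at ha
  have := h.abs_sub_le a.1 a.2 b.1 b.2
  rw [Real.dist_eq]
  linarith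

theorem midDefect_nonneg (h : IsShortPseudoDist ρ) (x w : E) : 0 ≤ midDefect ρ x w := by
  have h1 := h.triangle x (x + w) (x + w + w)
  have h2 := h.nonneg x (x + w + w)
  unfold midDefect
  nlinarith [sq_nonneg (ρ x (x + w) - ρ (x + w) (x + w + w))]

theorem eq_two_mul_of_midDefect_eq_zero (h : IsShortPseudoDist ρ) {x w : E}
    (h0 : midDefect ρ x w = 0) : ρ x (x + w + w) = 2 * ρ x (x + w) := by
  have h1 := h.triangle x (x + w) (x + w + w)
  have h2 := h.nonneg x (x + w + w)
  have h3 := h.nonneg x (x + w)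
  have h4 := h.nonneg (x + w) (x + w + w)
  unfold midDefect at h0
  -- Convexity of the square is strict, so the two short steps have the same length.
  have h5 : (ρ x (x + w) - ρ (x + w) (x + w + w)) ^ 2 ≤ 0 := by nlinarith
  have h6 : ρ x (x + w) - ρ (x + w) (x + w + w) = 0 := by
    simpa using le_antisymm h5 (sq_nonneg _)
  have h7 : ρ (x + w) (x + w + w) = ρ x (x + w) := by linarith
  rw [h7] at h0
  have h8 : (ρ x (x + w + w) / 2) ^ 2 = ρ x (x + w) ^ 2 := by linarith
  have h9 := (pow_left_inj₀ (by positivity) h3 two_ne_zero).1 h8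
  linarith

theorem abs_midDefect_sub_le (h : IsShortPseudoDist ρ) (x y w : E) :
    |midDefect ρ x w - midDefect ρ y w| ≤ 6 * ‖w‖ * ‖x - y‖ := by
  have sq_bound : ∀ a b c d : ℝ, 0 ≤ a → 0 ≤ b → a ≤ c → b ≤ c → |a - b| ≤ d →
      |a ^ 2 - b ^ 2| ≤ 2 * c * d := by
    intro a b c d ha hb hac hbc hd
    rw [sq_sub_sq, abs_mul, abs_of_nonneg (add_nonneg ha hb)]
    exact mul_le_mul (by linarith) hd (abs_nonneg _) (by linarith)
  have n1 : ∀ z : E, ρ z (z + w) ≤ ‖w‖ := fun z => by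
    simpa [norm_neg] using h.le_norm z (z + w)
  have n2 : ∀ z : E, ρ z (z + w + w) ≤ 2 * ‖w‖ := fun z => by
    linarith [h.triangle z (z + w) (z + w + w), n1 z, n1 (z + w)]
  have d1 := h.abs_sub_le x (x + w) y (y + w)
  have d2 := h.abs_sub_le (x + w) (x + w + w) (y + w) (y + w + w)
  have d3 := h.abs_sub_le x (x + w + w) y (y + w + w)
  simp only [add_sub_add_right_eq_sub] at d1 d2 d3
  have e1 := sq_bound _ _ ‖w‖ _ (h.nonneg x (x + w)) (h.nonneg y (y + w)) (n1 x) (n1 y) d1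
  have e2 := sq_bound _ _ ‖w‖ _ (h.nonneg (x + w) (x + w + w)) (h.nonneg (y + w) (y + w + w))
    (n1 _) (n1 _) d2
  have e3 := sq_bound _ _ (2 * ‖w‖) _ (h.nonneg x (x + w + w)) (h.nonneg y (y + w + w))
    (n2 _) (n2 _) d3
  unfold midDefect
  rw [abs_le] at e1 e2 e3 ⊢
  constructor <;> nlinarith

theorem isCompact_setOf : IsCompact {ρ : E → E → ℝ | IsShortPseudoDist ρ} := by
  have hK : IsCompact (Set.univ.pi fun x : E => Set.univ.pi fun y : E => Set.Icc (0 : ℝ) ‖x - y‖) :=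
    isCompact_univ_pi fun x => isCompact_univ_pi fun y => isCompact_Icc
  refine hK.of_isClosed_subset ?_ fun ρ h x _ y _ => ⟨h.nonneg x y, h.le_norm x y⟩
  have : {ρ : E → E → ℝ | IsShortPseudoDist ρ} =
      {ρ | (∀ x, ρ x x = 0) ∧ (∀ x y, ρ x y = ρ y x) ∧ (∀ x y z, ρ x z ≤ ρ x y + ρ y z) ∧
        ∀ x y, ρ x y ≤ ‖x - y‖} := by
    ext ρ
    exact ⟨fun h => ⟨h.1, h.2, h.3, h.4⟩, fun h => ⟨h.1, h.2.1, h.2.2.1, h.2.2.2⟩⟩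
  rw [this]
  simp only [Set.ofPred_and, Set.ofPred_forall]
  have hc : ∀ x y : E, Continuous fun ρ : E → E → ℝ => ρ x y :=
    fun x y => continuous_apply_apply x y
  refine IsClosed.inter ?_ (IsClosed.inter ?_ (IsClosed.inter ?_ ?_))
  · exact isClosed_iInter fun x => isClosed_eq (hc _ _) continuous_const
  · exact isClosed_iInter fun x => isClosed_iInter fun y => isClosed_eq (hc _ _) (hc _ _)
  · exact isClosed_iInter fun x => isClosed_iInter fun y => isClosed_iInter fun z =>
      isClosed_le (hc _ _) ((hc _ _).add (hc _ _))
  · exact isClosed_iInter fun x => isClosed_iInter fun y => isClosed_le (hc _ _) continuous_const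

variable [NormedSpace ℝ E]

/-- A pseudodistance without defects is a seminorm: speeds are unchanged under doubling of steps,
so comparing `2 ^ m`-fold steps from two base points, which differ by a bounded amount, shows
translation invariance. -/
theorem exists_seminorm_of_midDefect_eq_zero (h : IsShortPseudoDist ρ)
    (h0 : ∀ x w, midDefect ρ x w = 0) :
    ∃ p : Seminorm ℝ E, ∀ x y, ρ x y = p (x - y) := by
  have pow_mul : ∀ (m : ℕ) (x w : E), ρ x (x + (2 : ℝ) ^ m • w) = 2 ^ m * ρ x (x + w) := by
    intro m
    induction m with
    | zero => simp
    | succ m ih =>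
      intro x w
      have := h.eq_two_mul_of_midDefect_eq_zero (h0 x ((2 : ℝ) ^ m • w))
      rw [pow_succ, mul_comm, mul_smul, two_smul, ← add_assoc, this, ih]
      ring
  have pow_large : ∀ a b : ℝ, (∀ m : ℕ, 2 ^ m * a ≤ b) → a ≤ 0 := by
    intro a b hab
    by_contra! ha
    obtain ⟨m, hm⟩ := pow_unbounded_of_one_lt (b / a) (one_lt_two)
    rw [div_lt_iff₀ ha] at hm
    exact absurd (hab m) (not_le.2 hm)
  have transl_le : ∀ x y w : E, ρ x (x + w) ≤ ρ y (y + w) := by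
    intro x y w
    refine sub_nonpos.1 (pow_large _ (2 * ‖x - y‖) fun m => ?_)
    have := h.abs_sub_le x (x + (2 : ℝ) ^ m • w) y (y + (2 : ℝ) ^ m • w)
    rw [pow_mul, pow_mul, add_sub_add_right_eq_sub] at this
    linarith [le_abs_self (2 ^ m * ρ x (x + w) - 2 ^ m * ρ y (y + w))]
  have transl : ∀ x y : E, ρ x y = ρ 0 (y - x) := by
    intro x y
    refine le_antisymm ?_ ?_
    · simpa using transl_le x 0 (y - x)
    · simpa using transl_le 0 x (y - x)
  have add_le : ∀ u v : E, ρ 0 (u + v) ≤ ρ 0 u + ρ 0 v := by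
    intro u v
    have := h.triangle 0 u (u + v)
    rwa [transl u (u + v), add_sub_cancel_left] at this
  have neg_eq : ∀ u : E, ρ 0 (-u) = ρ 0 u := by
    intro u
    rw [h.symm 0 u, transl u 0, zero_sub]
  have nat_mul_le : ∀ (k : ℕ) (u : E), ρ 0 ((k : ℝ) • u) ≤ k * ρ 0 u := by
    intro k u
    induction k with
    | zero => simp [h.self]
    | succ k ih =>
      push_cast
      rw [add_smul, one_smul]
      linarith [add_le ((k : ℝ) • u) u]
  -- Replacing `2 ^ m * t` by its floor costs at most `‖u‖`, which is negligible as `m` grows.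
  have nonneg_mul_le : ∀ (t : ℝ) (u : E), 0 ≤ t → ρ 0 (t • u) ≤ t * ρ 0 u := by
    intro t u ht
    refine sub_nonpos.1 (pow_large _ ‖u‖ fun m => ?_)
    have h1 := pow_mul m 0 (t • u)
    rw [zero_add, zero_add, smul_smul] at h1
    set a : ℝ := 2 ^ m * t with ha
    have ha0 : 0 ≤ a := by positivity
    have h2 : ρ 0 ((a - ⌊a⌋₊) • u) ≤ ‖u‖ := by
      refine (h.le_norm _ _).trans ?_
      rw [zero_sub, norm_neg, norm_smul, Real.norm_of_nonneg (sub_nonneg.2 (Nat.floor_le ha0))]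
      exact mul_le_of_le_one_left (norm_nonneg _) (by linarith [Nat.lt_floor_add_one a])
    have h3 := add_le ((⌊a⌋₊ : ℝ) • u) ((a - ⌊a⌋₊) • u)
    rw [← add_smul, add_sub_cancel, h1] at h3
    have h4 := nat_mul_le ⌊a⌋₊ u
    have h5 := mul_le_mul_of_nonneg_right (Nat.floor_le ha0) (h.nonneg 0 u)
    rw [mul_sub, ← mul_assoc, ← ha]
    linarith
  refine ⟨Seminorm.ofSMulLE (fun u => ρ 0 u) (h.self 0) add_le fun t u => ?_, fun x y => ?_⟩
  · rcases le_total 0 t with ht | ht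
    · rw [Real.norm_of_nonneg ht]
      exact nonneg_mul_le t u ht
    · rw [Real.norm_of_nonpos ht, ← neg_eq, ← neg_smul]
      exact nonneg_mul_le (-t) u (neg_nonneg.2 ht)
  · rw [h.symm, transl]
    rfl

/-- Compactness in the product topology makes the rigidity of defect-free pseudodistances
quantitative: a pseudodistance whose defects are small at finitely many places, chosen in advance,
is close to a seminorm. -/
theorem exists_finset_midDefect_or_seminorm {K : Set E} (hK : IsCompact K) {δ : ℝ} (hδ : 0 < δ) :
    ∃ V : Finset (E × E), ∃ ε : ℝ, 0 < ε ∧ ∀ ρ : E → E → ℝ, IsShortPseudoDist ρ →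
      (∃ q ∈ V, ε < midDefect ρ q.1 q.2) ∨
        ∃ p : Seminorm ℝ E, ∀ x ∈ K, ∀ y ∈ K, |ρ x y - p (x - y)| ≤ δ := by
  classical
  suffices H : ∃ V : Finset (E × E), ∃ ε : ℝ, 0 < ε ∧
      ∀ ρ ∈ {ρ : E → E → ℝ | IsShortPseudoDist ρ}, IsShortPseudoDist ρ →
      (∃ q ∈ V, ε < midDefect ρ q.1 q.2) ∨
        ∃ p : Seminorm ℝ E, ∀ x ∈ K, ∀ y ∈ K, |ρ x y - p (x - y)| ≤ δ by
    obtain ⟨V, ε, hε, H⟩ := H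
    exact ⟨V, ε, hε, fun ρ hρ => H ρ hρ hρ⟩
  refine IsCompact.induction_on (p := fun S => ∃ V : Finset (E × E), ∃ ε : ℝ, 0 < ε ∧
      ∀ ρ ∈ S, IsShortPseudoDist ρ → (∃ q ∈ V, ε < midDefect ρ q.1 q.2) ∨
        ∃ p : Seminorm ℝ E, ∀ x ∈ K, ∀ y ∈ K, |ρ x y - p (x - y)| ≤ δ)
    isCompact_setOf ⟨∅, 1, one_pos, by simp⟩ ?_ ?_ ?_
  · rintro S T hST ⟨V, ε, hε, H⟩
    exact ⟨V, ε, hε, fun ρ hρ => H ρ (hST hρ)⟩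
  · rintro S T ⟨V, ε, hε, H⟩ ⟨V', ε', hε', H'⟩
    refine ⟨V ∪ V', min ε ε', lt_min hε hε', ?_⟩
    rintro ρ (hρ | hρ) h
    · refine (H ρ hρ h).imp_left fun ⟨q, hq, hlt⟩ => ⟨q, Finset.mem_union_left _ hq, ?_⟩
      exact (min_le_left _ _).trans_lt hlt
    · refine (H' ρ hρ h).imp_left fun ⟨q, hq, hlt⟩ => ⟨q, Finset.mem_union_right _ hq, ?_⟩
      exact (min_le_right _ _).trans_lt hlt
  · intro ρ₀ (h₀ : IsShortPseudoDist ρ₀)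
    have hc : ∀ x y : E, Continuous fun ρ : E → E → ℝ => ρ x y :=
      fun x y => continuous_apply_apply x y
    by_cases hz : ∀ x w, midDefect ρ₀ x w = 0
    · obtain ⟨p, hp⟩ := h₀.exists_seminorm_of_midDefect_eq_zero hz
      obtain ⟨F, -, hFfin, hF⟩ := hK.finite_cover_balls (show 0 < δ / 8 by linarith)
      refine ⟨{ρ | ∀ x ∈ F, ∀ y ∈ F, |ρ x y - ρ₀ x y| < δ / 2}, ?_, ∅, 1, one_pos, ?_⟩
      · refine mem_nhdsWithin_of_mem_nhds ?_
        simp only [Set.ofPred_forall]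
        refine (Filter.biInter_mem hFfin).2 fun x _ => (Filter.biInter_mem hFfin).2 fun y _ => ?_
        refine IsOpen.mem_nhds (isOpen_lt ((hc x y).sub continuous_const).abs continuous_const) ?_
        simpa using hδ
      · refine fun ρ hρ h => Or.inr ⟨p, fun x hx y hy => ?_⟩
        obtain ⟨x', hx', hxx⟩ := Set.mem_iUnion₂.1 (hF hx)
        obtain ⟨y', hy', hyy⟩ := Set.mem_iUnion₂.1 (hF hy)
        rw [Metric.mem_ball, dist_eq_norm] at hxx hyy
        have h1 := hρ x' hx' y' hy'
        have h2 := h.abs_sub_le x y x' y'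
        have h3 := h₀.abs_sub_le x y x' y'
        rw [← hp]
        rw [abs_lt] at h1
        rw [abs_le] at h2 h3 ⊢
        constructor <;> linarith
    · push Not at hz
      obtain ⟨x, w, hxw⟩ := hz
      have hpos := (h₀.midDefect_nonneg x w).lt_of_ne' hxw
      refine ⟨{ρ | midDefect ρ₀ x w / 2 < midDefect ρ x w}, ?_, {(x, w)}, midDefect ρ₀ x w / 2,
        half_pos hpos, ?_⟩
      · refine mem_nhdsWithin_of_mem_nhds (IsOpen.mem_nhds ?_ (half_lt_self hpos))
        refine isOpen_lt continuous_const ?_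
        unfold midDefect
        exact ((((hc _ _).pow 2).add ((hc _ _).pow 2)).div_const 2).sub
          (((hc _ _).div_const 2).pow 2)
      · exact fun ρ hρ _ => Or.inl ⟨(x, w), by simp, hρ⟩

/-- Zooming in at scale `h` around `c`. -/
theorem rescale (hρ : IsShortPseudoDist ρ) (c : E) {h : ℝ} (hh : 0 < h) :
    IsShortPseudoDist fun x y => ρ (c + h • x) (c + h • y) / h where
  self x := by simp [hρ.self]
  symm x y := by rw [hρ.symm]
  triangle x y z := by
    rw [← add_div]
    gcongr
    exact hρ.triangle _ _ _
  le_norm x y := by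
    rw [div_le_iff₀ hh]
    refine (hρ.le_norm _ _).trans_eq ?_
    rw [add_sub_add_left_eq_sub, ← smul_sub, norm_smul, Real.norm_of_nonneg hh.le, mul_comm]

end IsShortPseudoDist

theorem midDefect_rescale [NormedSpace ℝ E] (ρ : E → E → ℝ) (c x w : E) (h : ℝ) :
    midDefect (fun x y => ρ (c + h • x) (c + h • y) / h) x w =
      midDefect ρ (c + h • x) (h • w) / h ^ 2 := by
  unfold midDefect
  simp only [smul_add, ← add_assoc]
  ring

end ShortPseudoDist

/-! ### Telescoping of defects over dyadic scales -/

section Telescoping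

open Metric

variable {E : Type*} [NormedAddCommGroup E] [NormedSpace ℝ E] {ρ : E → E → ℝ}

/-- The squared speed of `ρ` on the step from `y` to `y + h • w`. -/
noncomputable def sqSpeed (ρ : E → E → ℝ) (w : E) (h : ℝ) (y : E) : ℝ :=
  (ρ y (y + h • w) / h) ^ 2

/-- The defect of the step `h • w` at `y`, in units of the scale `h`. -/
noncomputable def scaledDefect (ρ : E → E → ℝ) (w : E) (h : ℝ) (y : E) : ℝ :=
  midDefect ρ y (h • w) / h ^ 2

theorem scaledDefect_add_sqSpeed (ρ : E → E → ℝ) (w y : E) (h : ℝ) :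
    scaledDefect ρ w h y + sqSpeed ρ w (2 * h) y =
      (sqSpeed ρ w h y + sqSpeed ρ w h (y + h • w)) / 2 := by
  unfold scaledDefect sqSpeed midDefect
  rw [mul_smul, two_smul, ← add_assoc]
  ring

theorem sqSpeed_nonneg (ρ : E → E → ℝ) (w : E) (h : ℝ) (y : E) : 0 ≤ sqSpeed ρ w h y :=
  sq_nonneg _

namespace IsShortPseudoDist

theorem sqSpeed_le (hρ : IsShortPseudoDist ρ) (w y : E) {h : ℝ} (hh : 0 < h) :
    sqSpeed ρ w h y ≤ ‖w‖ ^ 2 := by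
  have h1 := hρ.le_norm y (y + h • w)
  rw [sub_add_cancel_left, norm_neg, norm_smul, Real.norm_of_nonneg hh.le] at h1
  refine pow_le_pow_left₀ (div_nonneg (hρ.nonneg _ _) hh.le) ?_ 2
  rwa [div_le_iff₀' hh]

theorem scaledDefect_nonneg (hρ : IsShortPseudoDist ρ) (w : E) (h : ℝ) (y : E) :
    0 ≤ scaledDefect ρ w h y :=
  div_nonneg (hρ.midDefect_nonneg _ _) (sq_nonneg _)

theorem abs_scaledDefect_sub_le (hρ : IsShortPseudoDist ρ) (w y y' : E) {h : ℝ} (hh : 0 < h) :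
    |scaledDefect ρ w h y - scaledDefect ρ w h y'| ≤ 6 * ‖w‖ * (‖y - y'‖ / h) := by
  have := hρ.abs_midDefect_sub_le y y' (h • w)
  rw [norm_smul, Real.norm_of_nonneg hh.le] at this
  rw [scaledDefect, scaledDefect, ← sub_div, abs_div, abs_of_nonneg (sq_nonneg h),
    div_le_iff₀ (by positivity)]
  refine this.trans_eq ?_
  field_simp

variable [MeasurableSpace E] [BorelSpace E]

theorem measurable_sqSpeed (hρ : IsShortPseudoDist ρ) (w : E) (h : ℝ) :
    Measurable (sqSpeed ρ w h) := by
  have : Continuous fun y => ρ y (y + h • w) :=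
    hρ.continuous.comp (continuous_id.prodMk (continuous_id.add continuous_const))
  exact ((this.div_const h).pow 2).measurable

/-- Enlarging the ball by the length of the step absorbs the translation by `h • w`. -/
theorem lintegral_scaledDefect_add_le (hρ : IsShortPseudoDist ρ) (μ : Measure E)
    [μ.IsAddRightInvariant] (c w : E) (r : ℝ) {h : ℝ} (hh : 0 < h) :
    ∫⁻ y in closedBall c r, ENNReal.ofReal (scaledDefect ρ w h y) ∂μ +
        ∫⁻ y in closedBall c r, ENNReal.ofReal (sqSpeed ρ w (2 * h) y) ∂μ ≤
      ∫⁻ y in closedBall c (r + h * ‖w‖), ENNReal.ofReal (sqSpeed ρ w h y) ∂μ := by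
  have hm := fun h => (hρ.measurable_sqSpeed w h).ennreal_ofReal
  rw [← lintegral_add_right _ (hm _)]
  have hpt : ∀ y, ENNReal.ofReal (scaledDefect ρ w h y) + ENNReal.ofReal (sqSpeed ρ w (2 * h) y) =
      2⁻¹ * ENNReal.ofReal (sqSpeed ρ w h y) +
        2⁻¹ * ENNReal.ofReal (sqSpeed ρ w h (y + h • w)) := by
    intro y
    have h2 : (2⁻¹ : ℝ≥0∞) = ENNReal.ofReal 2⁻¹ := by
      rw [ENNReal.ofReal_inv_of_pos two_pos, ENNReal.ofReal_ofNat]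
    rw [← ENNReal.ofReal_add (hρ.scaledDefect_nonneg _ _ _) (sqSpeed_nonneg _ _ _ _),
      scaledDefect_add_sqSpeed, h2, ← ENNReal.ofReal_mul (by norm_num),
      ← ENNReal.ofReal_mul (by norm_num), ← ENNReal.ofReal_add
        (mul_nonneg (by norm_num) (sqSpeed_nonneg _ _ _ _))
        (mul_nonneg (by norm_num) (sqSpeed_nonneg _ _ _ _))]
    congr 1
    ring
  simp only [hpt]
  have hnorm : ‖h • w‖ = h * ‖w‖ := by rw [norm_smul, Real.norm_of_nonneg hh.le]
  have hI : ∫⁻ y in closedBall c r, ENNReal.ofReal (sqSpeed ρ w h y) ∂μ ≤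
      ∫⁻ y in closedBall c (r + h * ‖w‖), ENNReal.ofReal (sqSpeed ρ w h y) ∂μ :=
    lintegral_mono_set (closedBall_subset_closedBall
      (by rw [← hnorm]; linarith [norm_nonneg (h • w)]))
  have hJ : ∫⁻ y in closedBall c r, ENNReal.ofReal (sqSpeed ρ w h (y + h • w)) ∂μ ≤
      ∫⁻ y in closedBall c (r + h * ‖w‖), ENNReal.ofReal (sqSpeed ρ w h y) ∂μ := by
    rw [← (measurePreserving_add_right μ (h • w)).setLIntegral_comp_preimage
      measurableSet_closedBall (hm h)]
    refine lintegral_mono_set fun y hy => ?_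
    rw [mem_closedBall, dist_eq_norm] at hy
    rw [Set.mem_preimage, mem_closedBall, dist_eq_norm, add_sub_right_comm, ← hnorm]
    exact (norm_add_le _ _).trans (by linarith)
  rw [lintegral_add_left ((hm h).const_mul _), lintegral_const_mul' _ _ (by simp),
    lintegral_const_mul' _ _ (by simp)]
  refine (add_le_add (mul_le_mul_right hI _) (mul_le_mul_right hJ _)).trans_eq ?_
  rw [← add_mul, ENNReal.inv_two_add_inv_two, one_mul]

/-- The defects at all dyadic scales below `S` telescope. The domain of integration grows slightly
from each scale to the next smaller one, which disposes of all boundary terms. -/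
theorem tsum_lintegral_scaledDefect_le (hρ : IsShortPseudoDist ρ) (μ : Measure E)
    [μ.IsAddRightInvariant] (c w : E) (r : ℝ) {S : ℝ} (hS : 0 < S) :
    ∑' j : ℕ, ∫⁻ y in closedBall c r, ENNReal.ofReal (scaledDefect ρ w (S / 2 ^ j) y) ∂μ ≤
      ENNReal.ofReal (‖w‖ ^ 2) * μ (closedBall c (r + 2 * S * ‖w‖)) := by
  -- Consecutive radii differ by `(S / 2 ^ j) * ‖w‖`, the length of the step at scale `S / 2 ^ j`.
  set rad : ℕ → ℝ := fun j => r + 2 * S * ‖w‖ - 2 * (S / 2 ^ j) * ‖w‖ with hrad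
  set u : ℕ → ℝ≥0∞ := fun j =>
    ∫⁻ y in closedBall c (rad j), ENNReal.ofReal (sqSpeed ρ w (2 * (S / 2 ^ j)) y) ∂μ with hu
  have hpos : ∀ j : ℕ, 0 < S / 2 ^ j := fun j => by positivity
  have hstep : ∀ j : ℕ,
      ∫⁻ y in closedBall c r, ENNReal.ofReal (scaledDefect ρ w (S / 2 ^ j) y) ∂μ + u j ≤
        u (j + 1) := by
    intro j
    have hr : r ≤ rad j := by
      have : S / 2 ^ j ≤ S := div_le_self hS.le (one_le_pow₀ one_le_two)
      have := mul_le_mul_of_nonneg_right this (norm_nonneg w)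
      simp only [hrad]
      linarith
    refine (add_le_add_left (lintegral_mono_set (closedBall_subset_closedBall hr)) _).trans ?_
    refine (hρ.lintegral_scaledDefect_add_le μ c w (rad j) (hpos j)).trans_eq ?_
    have h1 : 2 * (S / 2 ^ (j + 1)) = S / 2 ^ j := by
      rw [pow_succ]
      field_simp
    have h2 : rad (j + 1) = rad j + S / 2 ^ j * ‖w‖ := by
      simp only [hrad, h1]
      ring
    simp only [hu, h1, h2]
  have hsum : ∀ J : ℕ, ∑ j ∈ Finset.range J,
      ∫⁻ y in closedBall c r, ENNReal.ofReal (scaledDefect ρ w (S / 2 ^ j) y) ∂μ ≤ u J := by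
    intro J
    induction J with
    | zero => simp
    | succ J ih =>
      rw [Finset.sum_range_succ, add_comm]
      exact (add_le_add_right ih _).trans (hstep J)
  refine ENNReal.tsum_le_of_sum_range_le fun J => (hsum J).trans ?_
  rw [← setLIntegral_const]
  refine (lintegral_mono fun y => ENNReal.ofReal_le_ofReal
    (hρ.sqSpeed_le w y (mul_pos two_pos (hpos J)))).trans (lintegral_mono_set ?_)
  refine closedBall_subset_closedBall (sub_le_self _ ?_)
  have := hpos J
  positivity

end IsShortPseudoDist

end Telescoping

/-! ### Packing of cubes at one scale -/

section Packing

open Metric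

variable {n : ℕ} {ρ : (Fin n → ℝ) → (Fin n → ℝ) → ℝ}

/-- A defect larger than `ε` at one point of scale `h` persists, up to the factor `1 / 2`, on a
ball of radius `r * h` around it, because defects are Lipschitz. Translates of these balls by one
vector `h • x` are disjoint for disjoint cubes, so defects bound the total volume of the cubes. -/
theorem IsShortPseudoDist.tsum_pow_le_lintegral_scaledDefect (hρ : IsShortPseudoDist ρ)
    (x w : Fin n → ℝ) {ε r h : ℝ} (hε : 0 < ε) (hr : 0 < r) (hr2 : r ≤ 1 / 2)
    (hrε : 6 * ‖w‖ * r ≤ ε / 2) (hh : 0 < h) {ι : Type*} (c : ι → Fin n → ℝ)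
    (hdisj : Pairwise (Function.onFun Disjoint fun i => ball (c i) (h / 2)))
    {c₀ : Fin n → ℝ} {r₀ : ℝ} (hsub : ∀ i, ball (c i) (h / 2) ⊆ closedBall c₀ r₀)
    (hdef : ∀ i, ε < scaledDefect ρ w h (c i + h • x)) :
    ∑' _ : ι, ENNReal.ofReal (h ^ n) ≤ ENNReal.ofReal (2 / ε * ((2 * r) ^ n)⁻¹) *
      ∫⁻ y in closedBall c₀ (r₀ + h * ‖x‖), ENNReal.ofReal (scaledDefect ρ w h y) := by
  set ν : Measure (Fin n → ℝ) :=
    volume.withDensity fun y => ENNReal.ofReal (scaledDefect ρ w h y) with hν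
  set B : ι → Set (Fin n → ℝ) := fun i => ball (c i + h • x) (r * h) with hB
  have hBmem : ∀ i, ∀ y ∈ B i, y - h • x ∈ ball (c i) (h / 2) := by
    intro i y hy
    rw [hB, mem_ball, dist_eq_norm, ← sub_sub, sub_right_comm] at hy
    rw [mem_ball, dist_eq_norm]
    exact hy.trans_le (by nlinarith)
  have hBdisj : Pairwise (Function.onFun Disjoint B) := fun i j hij =>
    Set.disjoint_left.2 fun y hi hj =>
      Set.disjoint_left.1 (hdisj hij) (hBmem i y hi) (hBmem j y hj)
  have hBsub : ⋃ i, B i ⊆ closedBall c₀ (r₀ + h * ‖x‖) := by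
    refine Set.iUnion_subset fun i y hy => ?_
    have h1 := hsub i (hBmem i y hy)
    rw [mem_closedBall, dist_eq_norm] at h1 ⊢
    have h2 : y - c₀ = (y - h • x - c₀) + h • x := by abel
    rw [h2]
    refine (norm_add_le _ _).trans (add_le_add h1 ?_)
    rw [norm_smul, Real.norm_of_nonneg hh.le]
  have hone : ∀ i, ENNReal.ofReal (h ^ n) ≤ ENNReal.ofReal (2 / ε * ((2 * r) ^ n)⁻¹) * ν (B i) := by
    intro i
    have h1 : ENNReal.ofReal (ε / 2) * volume (B i) ≤ ν (B i) := by
      rw [hν, withDensity_apply _ measurableSet_ball, ← setLIntegral_const]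
      refine setLIntegral_mono' measurableSet_ball fun y hy => ENNReal.ofReal_le_ofReal ?_
      rw [mem_ball, dist_eq_norm] at hy
      have h2 := hρ.abs_scaledDefect_sub_le w y (c i + h • x) hh
      have h3 : 6 * ‖w‖ * (‖y - (c i + h • x)‖ / h) ≤ 6 * ‖w‖ * r := by
        gcongr
        rw [div_le_iff₀ hh]
        exact hy.le
      have h4 := (abs_le.1 (h2.trans (h3.trans hrε))).1
      linarith [hdef i]
    refine le_trans (le_of_eq ?_) (mul_le_mul_right h1 _)
    rw [hB, Real.volume_pi_ball _ (by positivity), Fintype.card_fin,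
      ← ENNReal.ofReal_mul (by positivity), ← ENNReal.ofReal_mul (by positivity)]
    congr 1
    rw [← mul_assoc 2 r h, mul_pow (2 * r) h]
    field_simp
  calc ∑' _ : ι, ENNReal.ofReal (h ^ n)
      ≤ ∑' i, ENNReal.ofReal (2 / ε * ((2 * r) ^ n)⁻¹) * ν (B i) := ENNReal.tsum_le_tsum hone
    _ = ENNReal.ofReal (2 / ε * ((2 * r) ^ n)⁻¹) * ∑' i, ν (B i) := ENNReal.tsum_mul_left
    _ ≤ ENNReal.ofReal (2 / ε * ((2 * r) ^ n)⁻¹) * ν (closedBall c₀ (r₀ + h * ‖x‖)) := by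
        gcongr
        exact (tsum_meas_le_meas_iUnion_of_disjoint ν (fun i => measurableSet_ball) hBdisj).trans
          (measure_mono hBsub)
    _ = _ := by rw [hν, withDensity_apply _ measurableSet_closedBall]

end Packing

/-! ### Dyadic cubes and the packing condition -/

section DyadicCubes

open Metric

variable {n : ℕ}

namespace Cube

theorem toSet_eq_closedBall (Q : Cube n) : Q.toSet = closedBall Q.center (Q.side / 2) := by
  ext y
  have hs := Q.side_pos
  rw [mem_closedBall, dist_pi_le_iff (by positivity), toSet, Set.mem_Icc, Pi.le_def, Pi.le_def,
    ← forall_and]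
  refine forall_congr' fun i => ?_
  rw [Real.dist_eq, abs_le]
  constructor <;> rintro ⟨h1, h2⟩ <;> constructor <;> linarith

theorem volume_toSet (Q : Cube n) : volume Q.toSet = ENNReal.ofReal (Q.side ^ n) := by
  have hs := Q.side_pos
  rw [toSet_eq_closedBall, Real.volume_pi_closedBall _ (by positivity), Fintype.card_fin]
  congr 2
  ring

end Cube

theorem disjoint_ball_of_dyadic {Q Q' : Cube n} (hQ : Q ∈ dyadicCubes n) (hQ' : Q' ∈ dyadicCubes n)
    (hside : Q.side = Q'.side) (hne : Q ≠ Q') :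
    Disjoint (ball Q.center (Q.side / 2)) (ball Q'.center (Q.side / 2)) := by
  obtain ⟨k, m, rfl⟩ := hQ
  obtain ⟨k', m', rfl⟩ := hQ'
  obtain rfl : k = k' := zpow_right_injective₀ two_pos (by norm_num) hside
  have hm : m ≠ m' := fun h => hne (by rw [h])
  obtain ⟨i, hi⟩ := Function.ne_iff.1 hm
  refine Set.disjoint_left.2 fun y hy hy' => ?_
  have hs : (0 : ℝ) < 2 ^ k := zpow_pos two_pos k
  have h1 := (dist_le_pi_dist y _ i).trans_lt (mem_ball.1 hy)
  have h2 := (dist_le_pi_dist y _ i).trans_lt (mem_ball.1 hy')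
  simp only [Cube.dyadic, Real.dist_eq] at h1 h2
  rw [abs_lt] at h1 h2
  rcases lt_or_gt_of_ne hi with h | h
  · have h3 : (m i : ℝ) + 1 ≤ m' i := by exact_mod_cast h
    nlinarith
  · have h3 : (m' i : ℝ) + 1 ≤ m i := by exact_mod_cast h
    nlinarith

/-- In dimension zero all cubes are the same point, and the sidelength of a subcube is arbitrary. -/
theorem exists_side_eq_div_two_pow [NeZero n] {Q R : Cube n} (hR : R ∈ dyadicCubes n)
    (hQ : Q ∈ dyadicSubcubes R) : ∃ j : ℕ, Q.side = R.side / 2 ^ j := by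
  obtain ⟨hQd, hQR⟩ := hQ
  have hle : Q.side ≤ R.side := by
    have hs := Q.side_pos
    obtain ⟨h1, h2⟩ := (Set.Icc_subset_Icc_iff (fun i => by simp only; linarith)).1 hQR
    have h1 := h1 0
    have h2 := h2 0
    simp only at h1 h2
    linarith
  obtain ⟨k, m, rfl⟩ := hQd
  obtain ⟨k', m', rfl⟩ := hR
  have hk : k ≤ k' := (zpow_le_zpow_iff_right₀ one_lt_two).1 hle
  refine ⟨(k' - k).toNat, ?_⟩
  simp only [Cube.dyadic]
  rw [← zpow_natCast, Int.toNat_of_nonneg (sub_nonneg.2 hk), ← zpow_sub₀ two_ne_zero,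
    sub_sub_cancel]

/-- For a fixed relative position `x` and step `w`, the dyadic cubes at which the rescaled
pseudodistance has a definite defect satisfy a Carleson packing condition. -/
theorem exists_tsum_volume_midDefect_le [NeZero n] (x w : Fin n → ℝ) {ε : ℝ} (hε : 0 < ε) :
    ∃ C : ℝ≥0, ∀ ρ : (Fin n → ℝ) → (Fin n → ℝ) → ℝ, IsShortPseudoDist ρ →
      ∀ R ∈ dyadicCubes n,
        ∑' Q : {Q : Cube n | Q ∈ dyadicSubcubes R ∧
            ε < scaledDefect ρ w Q.side (Q.center + Q.side • x)}, volume Q.1.toSet ≤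
          (C : ℝ≥0∞) * volume R.toSet := by
  obtain ⟨r, hr, hr2, hrε⟩ : ∃ r : ℝ, 0 < r ∧ r ≤ 1 / 2 ∧ 6 * ‖w‖ * r ≤ ε / 2 := by
    have hw := norm_nonneg w
    refine ⟨min (1 / 2) (ε / (12 * ‖w‖ + 1)), lt_min (by norm_num) (by positivity),
      min_le_left _ _, ?_⟩
    refine (mul_le_mul_of_nonneg_left (min_le_right _ _) (by positivity)).trans ?_
    rw [← mul_div_assoc, div_le_iff₀ (by positivity)]
    nlinarith
  set A := ENNReal.ofReal (2 / ε * ((2 * r) ^ n)⁻¹) with hA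
  -- The largest ball in the telescoping estimate has sidelength `a * R.side`.
  set a : ℝ := 2 * (1 / 2 + ‖x‖ + 2 * ‖w‖) with ha
  have ha0 : 0 ≤ a := by positivity
  set D := A * (ENNReal.ofReal (‖w‖ ^ 2) * ENNReal.ofReal (a ^ n)) with hD
  have hDtop : D ≠ ∞ := ENNReal.mul_ne_top ENNReal.ofReal_ne_top
    (ENNReal.mul_ne_top ENNReal.ofReal_ne_top ENNReal.ofReal_ne_top)
  refine ⟨D.toNNReal, fun ρ hρ R hR => ?_⟩
  rw [ENNReal.coe_toNNReal hDtop]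
  have hS := R.side_pos
  set S := R.side with hSdef
  set T : ℕ → Set (Cube n) := fun j => {Q | Q ∈ dyadicSubcubes R ∧ Q.side = S / 2 ^ j ∧
    ε < scaledDefect ρ w Q.side (Q.center + Q.side • x)} with hT
  have hTsub : {Q : Cube n | Q ∈ dyadicSubcubes R ∧
      ε < scaledDefect ρ w Q.side (Q.center + Q.side • x)} ⊆ ⋃ j, T j := by
    rintro Q ⟨hQ, hQdef⟩
    obtain ⟨j, hj⟩ := exists_side_eq_div_two_pow hR hQ
    exact Set.mem_iUnion.2 ⟨j, hQ, hj, hQdef⟩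
  have hscale : ∀ j, ∑' Q : T j, volume Q.1.toSet ≤ A *
      ∫⁻ y in closedBall R.center (S / 2 + S * ‖x‖),
        ENNReal.ofReal (scaledDefect ρ w (S / 2 ^ j) y) := by
    intro j
    have hh : 0 < S / 2 ^ j := by positivity
    have hhS : S / 2 ^ j ≤ S := div_le_self hS.le (one_le_pow₀ one_le_two)
    have hvol : ∀ Q : T j, volume Q.1.toSet = ENNReal.ofReal ((S / 2 ^ j) ^ n) := fun Q => by
      rw [Cube.volume_toSet, Q.2.2.1]
    rw [tsum_congr hvol]
    refine (hρ.tsum_pow_le_lintegral_scaledDefect x w hε hr hr2 hrε hh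
      (fun Q : T j => Q.1.center) (c₀ := R.center) (r₀ := S / 2) ?_ ?_ ?_).trans ?_
    · intro Q Q' hne
      have := disjoint_ball_of_dyadic Q.2.1.1 Q'.2.1.1 (Q.2.2.1.trans Q'.2.2.1.symm)
        (Subtype.coe_injective.ne hne)
      rwa [Q.2.2.1] at this
    · intro Q
      have := Q.2.1.2
      rw [Cube.toSet_eq_closedBall, Cube.toSet_eq_closedBall, Q.2.2.1] at this
      exact ball_subset_closedBall.trans this
    · intro Q
      have := Q.2.2.2
      rwa [Q.2.2.1] at this
    · gcongr
  calc _ ≤ ∑' Q : ⋃ j, T j, volume Q.1.toSet :=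
        ENNReal.tsum_mono_subtype (fun Q : Cube n => volume Q.toSet) hTsub
    _ ≤ ∑' j, ∑' Q : T j, volume Q.1.toSet :=
        ENNReal.tsum_iUnion_le_tsum (fun Q : Cube n => volume Q.toSet) T
    _ ≤ ∑' j : ℕ, A * ∫⁻ y in closedBall R.center (S / 2 + S * ‖x‖),
        ENNReal.ofReal (scaledDefect ρ w (S / 2 ^ j) y) := ENNReal.tsum_le_tsum hscale
    _ = A * ∑' j : ℕ, ∫⁻ y in closedBall R.center (S / 2 + S * ‖x‖),
        ENNReal.ofReal (scaledDefect ρ w (S / 2 ^ j) y) := ENNReal.tsum_mul_left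
    _ ≤ A * (ENNReal.ofReal (‖w‖ ^ 2) *
        volume (closedBall R.center (S / 2 + S * ‖x‖ + 2 * S * ‖w‖))) := by
        gcongr
        exact hρ.tsum_lintegral_scaledDefect_le volume R.center w _ hS
    _ = D * volume R.toSet := by
        rw [Real.volume_pi_closedBall _ (by positivity), Fintype.card_fin, Cube.volume_toSet, hD,
          mul_assoc A, mul_assoc (ENNReal.ofReal _),
          ← ENNReal.ofReal_mul (p := a ^ n) (by positivity), ← mul_pow]
        congr 4
        rw [ha, ← hSdef]
        ring

end DyadicCubes

/-! ### Metric differentiability on cubes -/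

section MetricDerivative

open Metric

variable {n : ℕ} {M : Type*} [MetricSpace M] {f : (Fin n → ℝ) → M}

theorem md_le_of_seminorm (Q : Cube n) (p : Seminorm ℝ (Fin n → ℝ)) {η : ℝ}
    (h : ∀ x ∈ Q.toSet, ∀ y ∈ Q.toSet, |dist (f x) (f y) - p (x - y)| ≤ η) :
    md f Q ≤ ENNReal.ofReal (η / Q.side) := by
  rw [ENNReal.ofReal_div_of_pos Q.side_pos, md]
  refine ENNReal.div_le_div_right ((iInf_le _ p).trans ?_) _
  exact iSup₂_le fun x hx => iSup₂_le fun y hy => ENNReal.ofReal_le_ofReal (h x hx y hy)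

theorem md_eq_zero_of_forall_eq (hf : ∀ x y, f x = f y) (Q : Cube n) : md f Q = 0 := by
  have := md_le_of_seminorm (f := f) Q 0 (η := 0) fun x _ y _ => by simp [hf x y]
  simpa using this

theorem LipschitzWith.isShortPseudoDist {L : ℝ≥0} (hL : 0 < L) (hf : LipschitzWith L f) :
    IsShortPseudoDist fun x y => dist (f x) (f y) / L where
  self x := by simp
  symm x y := by rw [dist_comm]
  triangle x y z := by
    rw [← add_div]
    gcongr
    exact dist_triangle _ _ _
  le_norm x y := by
    rw [div_le_iff₀' (by exact_mod_cast hL), ← dist_eq_norm]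
    exact hf.dist_le_mul x y

/-- A seminorm close to the rescaled pullback metric on the ball of radius `3 / 2`, the rescaled
copy of `3Q`, bounds `md (3Q)`. -/
theorem md_triple_le_of_rescale {L : ℝ≥0} (hL : 0 < L) {δ : ℝ} (hδ : 0 < δ) (Q : Cube n)
    (p : Seminorm ℝ (Fin n → ℝ))
    (hp : ∀ x ∈ closedBall (0 : Fin n → ℝ) (3 / 2), ∀ y ∈ closedBall (0 : Fin n → ℝ) (3 / 2),
      |dist (f (Q.center + Q.side • x)) (f (Q.center + Q.side • y)) / L / Q.side - p (x - y)| ≤ δ) :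
    md f Q.triple ≤ ENNReal.ofReal (δ * L) := by
  have hs := Q.side_pos
  have hL' : (0 : ℝ) < L := by exact_mod_cast hL
  have hmem : ∀ x ∈ Q.triple.toSet,
      Q.side⁻¹ • (x - Q.center) ∈ closedBall (0 : Fin n → ℝ) (3 / 2) := by
    intro x hx
    rw [Cube.toSet_eq_closedBall, mem_closedBall, dist_eq_norm] at hx
    rw [mem_closedBall_zero_iff, norm_smul, Real.norm_of_nonneg (inv_nonneg.2 hs.le),
      inv_mul_le_iff₀ hs]
    exact hx.trans_eq (by simp only [Cube.triple]; ring)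
  have hback : ∀ x, Q.center + Q.side • Q.side⁻¹ • (x - Q.center) = x := fun x => by
    rw [smul_inv_smul₀ hs.ne', add_sub_cancel]
  refine (md_le_of_seminorm Q.triple (L • p) (η := δ * L * Q.side) fun x hx y hy => ?_).trans
    (ENNReal.ofReal_le_ofReal ?_)
  · have h1 := hp _ (hmem x hx) _ (hmem y hy)
    rw [hback, hback, ← smul_sub, sub_sub_sub_cancel_right, map_smul_eq_mul,
      Real.norm_of_nonneg (inv_nonneg.2 hs.le)] at h1
    have h2 : dist (f x) (f y) - (L • p) (x - y) =
        (dist (f x) (f y) / L / Q.side - Q.side⁻¹ * p (x - y)) * (L * Q.side) := by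
      rw [smul_apply, NNReal.smul_def, smul_eq_mul]
      field_simp
    rw [h2, abs_mul, abs_of_pos (mul_pos hL' hs), mul_assoc]
    gcongr
  · simp only [Cube.triple]
    rw [div_le_iff₀ (by positivity)]
    nlinarith [mul_pos (mul_pos hδ hL') hs]

end MetricDerivative

theorem theorem1p1 (n : ℕ) (δ : ℝ) (hδ : 0 < δ) :
    ∃ C : ℝ≥0, ∀ (M : Type*) [MetricSpace M] (L : ℝ≥0) (f : (Fin n → ℝ) → M),
      LipschitzWith L f → ∀ R ∈ dyadicCubes n,
        ∑' Q : {Q : Cube n // Q ∈ dyadicSubcubes R ∧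
            ENNReal.ofReal (δ * (L : ℝ)) < md f Q.triple},
          volume Q.1.toSet ≤ (C : ℝ≥0∞) * volume R.toSet := by
  rcases Nat.eq_zero_or_pos n with rfl | hn
  -- In dimension zero every `f` is constant, and all values of `md` vanish.
  · refine ⟨0, fun M _ L f _ R _ => ?_⟩
    have : IsEmpty {Q : Cube 0 // Q ∈ dyadicSubcubes R ∧
        ENNReal.ofReal (δ * (L : ℝ)) < md f Q.triple} := ⟨fun Q => by
      have h := Q.2.2
      rw [md_eq_zero_of_forall_eq fun x y => by rw [Subsingleton.elim x y]] at h
      exact not_lt_zero h⟩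
    simp
  have : NeZero n := ⟨hn.ne'⟩
  obtain ⟨V, ε, hε, hV⟩ := IsShortPseudoDist.exists_finset_midDefect_or_seminorm
    (isCompact_closedBall (0 : Fin n → ℝ) (3 / 2)) hδ
  choose C hC using fun q : (Fin n → ℝ) × (Fin n → ℝ) =>
    exists_tsum_volume_midDefect_le q.1 q.2 hε
  refine ⟨∑ q ∈ V, C q, fun M _ L f hf R hR => ?_⟩
  rcases eq_or_ne L 0 with rfl | hL0
  -- For `L = 0` as well, `f` is constant, and the normalisation by `L` is not available.
  · have : IsEmpty {Q : Cube n // Q ∈ dyadicSubcubes R ∧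
        ENNReal.ofReal (δ * ((0 : ℝ≥0) : ℝ)) < md f Q.triple} := ⟨fun Q => by
      have h := Q.2.2
      rw [md_eq_zero_of_forall_eq fun x y =>
        dist_le_zero.1 (by simpa using hf.dist_le_mul x y)] at h
      exact not_lt_zero h⟩
    rw [tsum_empty]
    exact zero_le
  have hL : 0 < L := pos_iff_ne_zero.2 hL0
  have hρ := hf.isShortPseudoDist hL
  have hsub : {Q : Cube n | Q ∈ dyadicSubcubes R ∧
      ENNReal.ofReal (δ * (L : ℝ)) < md f Q.triple} ⊆
      ⋃ q ∈ V, {Q : Cube n | Q ∈ dyadicSubcubes R ∧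
        ε < scaledDefect (fun x y => dist (f x) (f y) / L) q.2 Q.side
          (Q.center + Q.side • q.1)} := by
    rintro Q ⟨hQ, hQmd⟩
    rcases hV _ (hρ.rescale Q.center Q.side_pos) with ⟨q, hq, hdef⟩ | ⟨p, hp⟩
    · rw [midDefect_rescale (fun x y => dist (f x) (f y) / L)] at hdef
      exact Set.mem_iUnion₂.2 ⟨q, hq, hQ, hdef⟩
    · exact absurd hQmd (md_triple_le_of_rescale hL hδ Q p hp).not_gt
  calc _ ≤ _ := ENNReal.tsum_mono_subtype (fun Q : Cube n => volume Q.toSet) hsub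
    _ ≤ _ := ENNReal.tsum_biUnion_le (fun Q : Cube n => volume Q.toSet) V _
    _ ≤ ∑ q ∈ V, (C q : ℝ≥0∞) * volume R.toSet := Finset.sum_le_sum fun q _ => hC q _ hρ R hR
    _ = _ := by rw [← Finset.sum_mul, ENNReal.ofNNReal_finsetSum]
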